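/- For a prime $p$ and a rational number $a$ with denominator not divisible by $p$, let $\langle a\rangle_p\in\{0,\dots,p-1\}$ denote the least nonnegative residue of $a$ modulo $p$. Let $[p]=1+q+\cdots+q^{p-1}\in\mathbb{Q}[q]$ and $(a;b)_0=1$, $(a;b)_n=(1-a)(1-ab)\cdots(1-ab^{n-1})$ for $n\ge 1$. For $f,g\in\mathbb{Q}(q)$ and $N\in\mathbb{Q}[q]$ write $f\equiv g\pmod N$ if $f-g=Nu/v$ with $u,v\in\mathbb{Q}[q]$ and $v$ coprime to $N$. **Theorem 2.3.** Let $p$ be an odd prime, let $m,r$ be positive integers with $p\nmid m$, and put $A=\langle -\tfrac{r}{m}\rangle_p$ and $B=\langle -\tfrac{m-r}{m}\rangle_p$. Let $s$ be an integer with $0\le s\le\min\{A,B\}$, and for $k\ge s$ let $$t_k=\frac{(q^m;q^m)_{2k}\,(q^r;q^m)_k\,(q^{m-r};q^m)_k\,q^{mk}}{(q^m;q^m)_{k-s}\,(q^m;q^m)_{k+s}\,(q^{2m};q^{2m})_k^2}\in\mathbb{Q}(q).$$ If $A\equiv s+1\pmod 2$, then $$\sum_{k=s}^{\frac{p-1}{2}}t_k\equiv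 0\pmod{[p]^2}\qquad\text{and}\qquad \sum_{k=s}^{p-1}t_k\equiv 0\pmod{[p]^2}.$$ If $A\equiv s\pmod 2$, then $$\sum_{k=s}^{\frac{p-1}{2}}t_k\equiv(-1)^{\frac{p-1}{2}+s}\,q^{m\left(\frac{p^2-1}{4}-s^2\right)}\,\frac{(q^m;q^{2m})_{\frac{A-s}{2}}\,(q^m;q^{2m})_{\frac{B-s}{2}}\,(q^{-mA};q^m)_s\,(q^{-mB};q^m)_s}{(q^{2m};q^{2m})_{\frac{A+s}{2}}\,(q^{2m};q^{2m})_{\frac{B+s}{2}}}\pmod{[p]}.$$ -/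

import Mathlib

open Polynomial

noncomputable section

/-- The `q`-integer `[n] = 1 + q + ⋯ + q ^ (n - 1)`, a polynomial in the indeterminate `q` over `ℚ`. -/
def qInteger (n : ℕ) : ℚ[X] := ∑ i ∈ Finset.range n, (X : ℚ[X]) ^ i

/-- The `q`-shifted factorial `(a; b)_n = (1 - a) (1 - a b) ⋯ (1 - a b ^ (n - 1))` with base `b`. -/
def qShifted {K : Type*} [Field K] (a b : K) (n : ℕ) : K :=
  ∏ i ∈ Finset.range n, (1 - a * b ^ i)

/-- The indeterminate `q` of the field `ℚ(q)`, raised to an integer power. -/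
def qPow (e : ℤ) : RatFunc ℚ := (RatFunc.X : RatFunc ℚ) ^ e

/-- Congruence of rational functions in `q` modulo a polynomial `N`: the difference `f - g` is of
the form `N u / v` with polynomials `u`, `v` such that the denominator `v` is coprime to `N`. -/
def RatFuncModEq (N : ℚ[X]) (f g : RatFunc ℚ) : Prop :=
  ∃ u v : ℚ[X], IsCoprime v N ∧
    f - g = algebraMap ℚ[X] (RatFunc ℚ) (N * u) / algebraMap ℚ[X] (RatFunc ℚ) v

/-- `⟨a⟩_p`, the least nonnegative residue modulo the prime `p` of a rational number `a` whose
denominator is not divisible by `p` (the cast is the numerator of `a` divided by its denominator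
in the field `ZMod p`). -/
def leastResidue (p : ℕ) [Fact p.Prime] (a : ℚ) : ℕ := ((a : ZMod p)).val

/-- The `k`-th summand
`(q^m;q^m)_{2k} (q^r;q^m)_k (q^{m-r};q^m)_k q^{mk} /
  ((q^m;q^m)_{k-s} (q^m;q^m)_{k+s} (q^{2m};q^{2m})_k ^ 2)`, used for `s ≤ k`. -/
def qSummand (m r s k : ℕ) : RatFunc ℚ :=
  qShifted (qPow m) (qPow m) (2 * k) * qShifted (qPow r) (qPow m) k *
      qShifted (qPow ((m : ℤ) - r)) (qPow m) k * qPow (m * k) /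
    (qShifted (qPow m) (qPow m) (k - s) * qShifted (qPow m) (qPow m) (k + s) *
      qShifted (qPow (2 * m)) (qPow (2 * m)) k ^ 2)

end

/-!
Put `Q = q ^ m` and `k = s + j`. The parameters `x = q ^ r` and `y = q ^ (m - r)` satisfy `x y = Q`,
and `(1 - x Q ^ i) (1 - y Q ^ i) = 1 + Q ^ (2 i + 1) - Q ^ i (x + y)`. Hence the sum of the `t_k`
over `s ≤ k < p - s` is the value `P (x + y)` of a polynomial `P` over the ring of functions that
are integral at `[p]` (`exists_polynomial_of_sum`). The remaining terms with `k > (p - 1) / 2` are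
divisible by `[p] ^ 2` (`qVal_qSummand_le`), so both sums in question agree with `P (x + y)` modulo
`[p] ^ 2`. Congruences modulo powers of `[p]` are expressed through the `[p]`-adic valuation.

Write `y_C = Q ^ (-C) + Q ^ (C + 1)`. Then
`x + y - y_C = -Q ^ (-C) (1 - q ^ r Q ^ C) (1 - q ^ (m - r) Q ^ C)`, so `y_A` and `y_B` are both
congruent to `x + y` modulo `[p]`. The values `P (y_A)` and `P (y_B)` are terminating sums,
evaluated by Andrews' `q`-analogue of Watson's formula, which follows here from a first-order
recurrence in steps of two (`sum_watsonTerm_telescope`).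

If `A - s` is odd, so is `B - s`, because `A + B = p - 1`. Both values vanish
(`sum_watsonTerm_odd`). If `A ≠ B`, then `P` is divisible by `(Y - y_A) (Y - y_B)`, and the value at
`x + y` is divisible by `[p] ^ 2`; if `A = B`, then `x + y - y_A` itself is divisible by `[p] ^ 2`.

If `A - s` is even, then `P (x + y)` is congruent to `P (y_A)` modulo `[p]`, which has a closed form
(`sum_watsonTerm_even`). The reflection `j ↦ p - j` of the exponents modulo `p`
(`pow_mul_prod_reflect`) turns it into the form symmetric in `A` and `B`.
-/

/-! ### `q`-shifted factorials -/

section QShifted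

variable {K : Type*} [Field K]

lemma qShifted_zero (a b : K) : qShifted a b 0 = 1 := by simp [qShifted]

lemma qShifted_succ (a b : K) (n : ℕ) :
    qShifted a b (n + 1) = qShifted a b n * (1 - a * b ^ n) := by
  simp [qShifted, Finset.prod_range_succ]

/-- Removing the first factor of `(a; b)_{n+1}` against removing the last one. -/
lemma one_sub_mul_qShifted (a b : K) (n : ℕ) :
    (1 - a) * qShifted (a * b) b n = qShifted a b n * (1 - a * b ^ n) := by
  rw [← qShifted_succ, qShifted, qShifted, Finset.prod_range_succ']
  simp [pow_succ', mul_assoc, mul_comm]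

lemma qShifted_ne_zero {a b : K} {n : ℕ} (h : ∀ i < n, a * b ^ i ≠ 1) : qShifted a b n ≠ 0 :=
  Finset.prod_ne_zero_iff.mpr fun i hi =>
    sub_ne_zero.mpr (h i (Finset.mem_range.mp hi)).symm

lemma qShifted_eq_zero {a b : K} {n i : ℕ} (hi : i < n) (h : a * b ^ i = 1) :
    qShifted a b n = 0 :=
  Finset.prod_eq_zero (Finset.mem_range.mpr hi) (by rw [h, sub_self])

end QShifted

/-! ### Andrews' terminating `q`-Watson sum -/

noncomputable section Watson

variable {K : Type*} [Field K]

/-- The factor of the summand that does not involve the parameters `q ^ r` and `q ^ (m - r)`, with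
`Q = q ^ m` and with `k = s + j`, so that `j` runs from `0`. -/
def watsonCoeff (Q : K) (s j : ℕ) : K :=
  qShifted Q Q (2 * (s + j)) * Q ^ (s + j) /
    (qShifted Q Q j * qShifted Q Q (2 * s + j) * qShifted (Q ^ 2) (Q ^ 2) (s + j) ^ 2)

/-- The summand of the terminating Watson-type sum, where `a` plays the role of `Q ^ A`. -/
def watsonTerm (Q : K) (s : ℕ) (a : K) (j : ℕ) : K :=
  watsonCoeff Q s j * (qShifted a⁻¹ Q (s + j) * qShifted (a * Q) Q (s + j))

/-- The hypothesis that `Q` is no root of unity keeps all denominators of the sum from vanishing. -/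
lemma qShifted_self_ne_zero {Q : K} (hQ : ∀ j : ℕ, 0 < j → Q ^ j ≠ 1) (n : ℕ) :
    qShifted Q Q n ≠ 0 :=
  qShifted_ne_zero fun i _ => by rw [← pow_succ']; exact hQ _ i.succ_pos

lemma qShifted_sq_sq_ne_zero {Q : K} (hQ : ∀ j : ℕ, 0 < j → Q ^ j ≠ 1) (n : ℕ) :
    qShifted (Q ^ 2) (Q ^ 2) n ≠ 0 :=
  qShifted_ne_zero fun i _ => by rw [← pow_succ', ← pow_mul]; exact hQ _ (by omega)

lemma watsonCoeff_succ {Q : K} (hQ : ∀ j : ℕ, 0 < j → Q ^ j ≠ 1) (s j : ℕ) :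
    watsonCoeff Q s (j + 1) *
        ((1 - Q ^ (j + 1)) * (1 - Q ^ (2 * s + (j + 1))) * (1 - Q ^ (2 * (s + (j + 1))))) =
      watsonCoeff Q s j * (Q * (1 - Q ^ (2 * (s + j) + 1))) := by
  have h1 : 1 - Q ^ (j + 1) ≠ 0 := sub_ne_zero.mpr (hQ _ (by omega)).symm
  have h2 : 1 - Q ^ (2 * s + j + 1) ≠ 0 := sub_ne_zero.mpr (hQ _ (by omega)).symm
  have h3 : 1 - Q ^ (2 * (s + j) + 2) ≠ 0 := sub_ne_zero.mpr (hQ _ (by omega)).symm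
  have e1 := qShifted_self_ne_zero hQ j
  have e2 := qShifted_self_ne_zero hQ (2 * s + j)
  have e3 := qShifted_sq_sq_ne_zero hQ (s + j)
  have n1 : qShifted Q Q (j + 1) = qShifted Q Q j * (1 - Q ^ (j + 1)) := by
    rw [qShifted_succ, ← pow_succ']
  have n2 : qShifted Q Q (2 * s + (j + 1)) =
      qShifted Q Q (2 * s + j) * (1 - Q ^ (2 * s + j + 1)) := by
    rw [← add_assoc, qShifted_succ, ← pow_succ']
  have n3 : qShifted (Q ^ 2) (Q ^ 2) (s + (j + 1)) =
      qShifted (Q ^ 2) (Q ^ 2) (s + j) * (1 - Q ^ (2 * (s + j) + 2)) := by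
    rw [← add_assoc, qShifted_succ, ← pow_succ', ← pow_mul]; rfl
  have n4 : qShifted Q Q (2 * (s + (j + 1))) =
      qShifted Q Q (2 * (s + j)) * (1 - Q ^ (2 * (s + j) + 1)) * (1 - Q ^ (2 * (s + j) + 2)) := by
    rw [show 2 * (s + (j + 1)) = 2 * (s + j) + 1 + 1 by ring, qShifted_succ, qShifted_succ,
      ← pow_succ', ← pow_succ']
  rw [watsonCoeff, watsonCoeff, n1, n2, n3, n4,
    show 2 * (s + (j + 1)) = 2 * (s + j) + 2 by ring, show 2 * s + (j + 1) = 2 * s + j + 1 by ring,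
    show s + (j + 1) = s + j + 1 by ring, pow_succ Q (s + j)]
  field_simp

lemma qShifted_shift_two (x b : K) (n : ℕ) :
    (1 - x) * (1 - x * b) * qShifted (x * b * b) b n =
      qShifted x b n * ((1 - x * b ^ n) * (1 - x * b * b ^ n)) := by
  linear_combination (1 - x) * one_sub_mul_qShifted (x * b) b n +
    (1 - x * b * b ^ n) * one_sub_mul_qShifted x b n

/-- The `q`-Zeilberger recurrence in the parameter `a`, with a closed form for the partial sums. It
is multiplied by `(1 - a Q) (1 - a Q ^ 2)` so that no division by a vanishing factor occurs when `a`
is a power of `Q` and the sum terminates. -/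
lemma sum_watsonTerm_telescope {Q : K} (hQ0 : Q ≠ 0) (hQ : ∀ j : ℕ, 0 < j → Q ^ j ≠ 1)
    {a : K} (ha : a ≠ 0) (s n : ℕ) :
    (1 - a * Q) * (1 - a * Q ^ 2) *
        ((1 - a * Q ^ 2 / Q ^ s) * (1 - a * Q ^ 2 * Q ^ s) *
            ∑ j ∈ Finset.range n, watsonTerm Q s (a * Q ^ 2) j -
          Q * (1 - a * Q * Q ^ s) * (1 - a * Q / Q ^ s) *
            ∑ j ∈ Finset.range n, watsonTerm Q s a j) =
      -(a * Q ^ 2) * (1 - a ^ 2 * Q ^ 3) * (Q ^ (s + n))⁻¹ *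
        ((1 - Q ^ n) * (1 - Q ^ (2 * s + n)) * (1 - Q ^ (2 * (s + n)))) * watsonCoeff Q s n *
        (qShifted (a * Q ^ 2)⁻¹ Q (s + n) * qShifted (a * Q) Q (s + n)) := by
  induction n with
  | zero => simp
  | succ n ih =>
    have hc := watsonCoeff_succ hQ s n
    have hl := qShifted_shift_two (a * Q ^ 2)⁻¹ Q (s + n)
    have hr := qShifted_shift_two (a * Q) Q (s + n)
    have hx : (a * Q ^ 2)⁻¹ * Q * Q = a⁻¹ := by field_simp
    rw [hx] at hl
    have hy : a * Q * Q * Q = a * Q ^ 2 * Q := by ring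
    rw [hy] at hr
    have t2 : (1 - a * Q) * (1 - a * Q ^ 2) * watsonTerm Q s (a * Q ^ 2) n =
        watsonCoeff Q s n * (qShifted (a * Q ^ 2)⁻¹ Q (s + n) * qShifted (a * Q) Q (s + n)) *
          ((1 - a * Q * Q ^ (s + n)) * (1 - a * Q ^ 2 * Q ^ (s + n))) := by
      rw [watsonTerm]
      linear_combination watsonCoeff Q s n * qShifted (a * Q ^ 2)⁻¹ Q (s + n) * hr
    have t1 : (1 - a * Q) * (1 - a * Q ^ 2) * watsonTerm Q s a n =
        watsonCoeff Q s n * (qShifted (a * Q ^ 2)⁻¹ Q (s + n) * qShifted (a * Q) Q (s + n)) *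
          ((a * Q - Q ^ (s + n)) * (a * Q ^ 2 - Q ^ (s + n))) := by
      rw [watsonTerm]
      have hl' : (1 - a * Q) * (1 - a * Q ^ 2) * qShifted a⁻¹ Q (s + n) =
          qShifted (a * Q ^ 2)⁻¹ Q (s + n) *
            ((a * Q - Q ^ (s + n)) * (a * Q ^ 2 - Q ^ (s + n))) := by
        have z1 : (1 - (a * Q ^ 2)⁻¹) * (1 - (a * Q ^ 2)⁻¹ * Q) * (a ^ 2 * Q ^ 3) =
            (1 - a * Q) * (1 - a * Q ^ 2) := by field_simp; ring
        have z2 : (1 - (a * Q ^ 2)⁻¹ * Q ^ (s + n)) * (1 - (a * Q ^ 2)⁻¹ * Q * Q ^ (s + n)) *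
            (a ^ 2 * Q ^ 3) = (a * Q - Q ^ (s + n)) * (a * Q ^ 2 - Q ^ (s + n)) := by
          field_simp
        rw [← z1, ← z2]
        linear_combination a ^ 2 * Q ^ 3 * hl
      linear_combination watsonCoeff Q s n * qShifted (a * Q) Q (s + n) * hl'
    have sl : qShifted (a * Q ^ 2)⁻¹ Q (s + (n + 1)) =
        qShifted (a * Q ^ 2)⁻¹ Q (s + n) * (1 - (a * Q ^ 2)⁻¹ * Q ^ (s + n)) := by
      rw [← add_assoc, qShifted_succ]
    have sr : qShifted (a * Q) Q (s + (n + 1)) =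
        qShifted (a * Q) Q (s + n) * (1 - a * Q * Q ^ (s + n)) := by
      rw [← add_assoc, qShifted_succ]
    rw [Finset.sum_range_succ, Finset.sum_range_succ, sl, sr, mul_assoc _ _ (watsonCoeff Q s (n + 1)),
      mul_comm _ (watsonCoeff Q s (n + 1)), hc]
    generalize watsonCoeff Q s n = c at *
    generalize qShifted (a * Q ^ 2)⁻¹ Q (s + n) = D at *
    generalize qShifted (a * Q) Q (s + n) = E at *
    generalize ∑ j ∈ Finset.range n, watsonTerm Q s (a * Q ^ 2) j = S2 at *
    generalize ∑ j ∈ Finset.range n, watsonTerm Q s a j = S1 at *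
    -- All terms are rational multiples of `c * (D * E)`; `key` is the certificate identity, a
    -- polynomial identity in `a`, `Q`, `Q ^ s` and `Q ^ n` after clearing denominators.
    have key : (1 - a * Q ^ 2 / Q ^ s) * (1 - a * Q ^ 2 * Q ^ s) *
          ((1 - a * Q * Q ^ (s + n)) * (1 - a * Q ^ 2 * Q ^ (s + n))) -
        Q * (1 - a * Q * Q ^ s) * (1 - a * Q / Q ^ s) *
          ((a * Q - Q ^ (s + n)) * (a * Q ^ 2 - Q ^ (s + n))) =
        -(a * Q ^ 2) * (1 - a ^ 2 * Q ^ 3) * ((Q ^ (s + (n + 1)))⁻¹ *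
          (Q * (1 - Q ^ (2 * (s + n) + 1))) * ((1 - (a * Q ^ 2)⁻¹ * Q ^ (s + n)) *
          (1 - a * Q * Q ^ (s + n))) - (Q ^ (s + n))⁻¹ *
          ((1 - Q ^ n) * (1 - Q ^ (2 * s + n)) * (1 - Q ^ (2 * (s + n))))) := by
      have ht : Q ^ s ≠ 0 := pow_ne_zero _ hQ0
      have hn : Q ^ n ≠ 0 := pow_ne_zero _ hQ0
      simp only [pow_add, pow_mul, pow_two, pow_one, mul_pow]
      generalize Q ^ s = t at *
      generalize Q ^ n = y at *
      field_simp
      ring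
    linear_combination ih + (1 - a * Q ^ 2 / Q ^ s) * (1 - a * Q ^ 2 * Q ^ s) * t2 -
      Q * (1 - a * Q * Q ^ s) * (1 - a * Q / Q ^ s) * t1 + c * (D * E) * key

end Watson

section WatsonEval

variable {K : Type*} [Field K]

/-- A term of the sum vanishes beyond the point of termination. -/
lemma watsonTerm_eq_zero {Q : K} (hQ0 : Q ≠ 0) {s n j : ℕ} (h : n < j) :
    watsonTerm Q s (Q ^ (s + n)) j = 0 := by
  rw [watsonTerm, qShifted_eq_zero (i := s + n) (by omega)
    (inv_mul_cancel₀ (pow_ne_zero _ hQ0)), zero_mul, mul_zero]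

/-- The recurrence for the terminating sums themselves, where the boundary term of the telescoping
vanishes. -/
lemma sum_watsonTerm_rec {Q : K} (hQ0 : Q ≠ 0) (hQ : ∀ j : ℕ, 0 < j → Q ^ j ≠ 1)
    (s n L : ℕ) (hL : n + 3 ≤ L) :
    (1 - Q ^ (n + 2)) * (1 - Q ^ (2 * s + n + 2)) *
        ∑ j ∈ Finset.range L, watsonTerm Q s (Q ^ (s + (n + 2))) j =
      Q * (1 - Q ^ (2 * s + n + 1)) * (1 - Q ^ (n + 1)) *
        ∑ j ∈ Finset.range L, watsonTerm Q s (Q ^ (s + n)) j := by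
  have h := sum_watsonTerm_telescope hQ0 hQ (pow_ne_zero (s + n) hQ0) s L
  have ht : Q ^ s ≠ 0 := pow_ne_zero _ hQ0
  have hz : qShifted (Q ^ (s + n) * Q ^ 2)⁻¹ Q (s + L) = 0 :=
    qShifted_eq_zero (i := s + n + 2) (by omega) (by
      rw [← pow_add]; exact inv_mul_cancel₀ (pow_ne_zero _ hQ0))
  have e1 : Q ^ (s + n) * Q ^ 2 / Q ^ s = Q ^ (n + 2) := by
    rw [div_eq_iff ht]; ring
  have e2 : Q ^ (s + n) * Q / Q ^ s = Q ^ (n + 1) := by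
    rw [div_eq_iff ht]; ring
  have e3 : Q ^ (s + n) * Q ^ 2 * Q ^ s = Q ^ (2 * s + n + 2) := by ring
  have e4 : Q ^ (s + n) * Q * Q ^ s = Q ^ (2 * s + n + 1) := by ring
  have e5 : Q ^ (s + n) * Q ^ 2 = Q ^ (s + (n + 2)) := by ring
  have w1 : 1 - Q ^ (s + n) * Q ≠ 0 := by
    rw [← pow_succ]; exact sub_ne_zero.mpr (hQ _ (by omega)).symm
  have w2 : 1 - Q ^ (s + n) * Q ^ 2 ≠ 0 := by
    rw [← pow_add]; exact sub_ne_zero.mpr (hQ _ (by omega)).symm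
  rw [hz, zero_mul, mul_zero, e1, e2, e3, e4] at h
  have h' := (mul_eq_zero.mp h).resolve_left (mul_ne_zero w1 w2)
  rw [e5] at h'
  exact sub_eq_zero.mp h'

/-- The terminating sum vanishes if its length is even. -/
lemma sum_watsonTerm_odd {Q : K} (hQ0 : Q ≠ 0) (hQ : ∀ j : ℕ, 0 < j → Q ^ j ≠ 1)
    (s n L : ℕ) (hn : Odd n) (hL : n + 1 ≤ L) :
    ∑ j ∈ Finset.range L, watsonTerm Q s (Q ^ (s + n)) j = 0 := by
  obtain ⟨n, rfl⟩ := hn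
  induction n with
  | zero =>
    have hsum : ∑ j ∈ Finset.range L, watsonTerm Q s (Q ^ (s + 1)) j =
        ∑ j ∈ Finset.range 2, watsonTerm Q s (Q ^ (s + 1)) j := by
      refine (Finset.sum_subset (Finset.range_mono (by omega)) fun j _ hj => ?_).symm
      exact watsonTerm_eq_zero hQ0 (by simpa using hj)
    have hc := watsonCoeff_succ hQ s 0
    have h1 : 1 - Q ≠ 0 := sub_ne_zero.mpr (by simpa using (hQ 1 one_pos).symm)
    have h2 : 1 - Q ^ (2 * s + 1) ≠ 0 := sub_ne_zero.mpr (hQ _ (by omega)).symm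
    have h3 : 1 - Q ^ (2 * s + 2) ≠ 0 := sub_ne_zero.mpr (hQ _ (by omega)).symm
    simp only [zero_add, add_zero, pow_one] at hc
    rw [show 2 * (s + 1) = 2 * s + 2 by ring] at hc
    have hc' : watsonCoeff Q s 1 * ((1 - Q) * (1 - Q ^ (2 * s + 2))) = watsonCoeff Q s 0 * Q :=
      mul_right_cancel₀ h2 (by linear_combination hc)
    rw [mul_zero, zero_add, hsum]
    simp only [Finset.sum_range_succ, Finset.sum_range_zero, watsonTerm, zero_add, add_zero,
      qShifted_succ]
    have e1 : (Q ^ (s + 1))⁻¹ * Q ^ s = Q⁻¹ := by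
      have := pow_ne_zero s hQ0
      rw [pow_succ]; field_simp
    have e2 : Q ^ (s + 1) * Q * Q ^ s = Q ^ (2 * s + 2) := by ring
    rw [e1, e2]
    have e3 : watsonCoeff Q s 1 * ((1 - Q⁻¹) * (1 - Q ^ (2 * s + 2))) = -watsonCoeff Q s 0 := by
      apply mul_right_cancel₀ hQ0
      have : Q⁻¹ * Q = 1 := inv_mul_cancel₀ hQ0
      linear_combination -hc' - watsonCoeff Q s 1 * (1 - Q ^ (2 * s + 2)) * this
    linear_combination qShifted (Q ^ (s + 1))⁻¹ Q s * qShifted (Q ^ (s + 1) * Q) Q s * e3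
  | succ n ih =>
    have h := sum_watsonTerm_rec hQ0 hQ s (2 * n + 1) L (by omega)
    rw [ih (by omega), mul_zero] at h
    refine (mul_eq_zero.mp h).resolve_left (mul_ne_zero ?_ ?_) <;>
      exact sub_ne_zero.mpr (hQ _ (by omega)).symm

/-- The closed form of the terminating sum if its length is odd (Andrews' terminating `q`-analogue
of Watson's summation formula). -/
lemma sum_watsonTerm_even {Q : K} (hQ0 : Q ≠ 0) (hQ : ∀ j : ℕ, 0 < j → Q ^ j ≠ 1)
    (s n L : ℕ) (hL : 2 * n + 1 ≤ L) :
    ∑ j ∈ Finset.range L, watsonTerm Q s (Q ^ (s + 2 * n)) j =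
      qShifted (Q ^ (s + 2 * n))⁻¹ Q s * qShifted (Q ^ (s + 2 * n) * Q) Q s *
        Q ^ (s + (2 * s + 1) * n) * qShifted Q (Q ^ 2) n ^ 2 /
          qShifted (Q ^ 2) (Q ^ 2) (n + s) ^ 2 := by
  induction n with
  | zero =>
    rw [Finset.sum_eq_single_of_mem 0 (Finset.mem_range.mpr (by omega)) fun j _ hj =>
      watsonTerm_eq_zero hQ0 (Nat.pos_of_ne_zero hj)]
    have h1 := qShifted_self_ne_zero hQ (2 * s)
    have h2 := qShifted_sq_sq_ne_zero hQ s
    simp only [watsonTerm, watsonCoeff, mul_zero, add_zero, zero_add, qShifted_zero]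
    field_simp
  | succ n ih =>
    have h := sum_watsonTerm_rec hQ0 hQ s (2 * n) L (by omega)
    rw [ih (by omega)] at h
    have ht : Q ^ s ≠ 0 := pow_ne_zero _ hQ0
    have n1 : 1 - Q ^ (2 * n + 2) ≠ 0 := sub_ne_zero.mpr (hQ _ (by omega)).symm
    have n2 : 1 - Q ^ (2 * s + 2 * n + 2) ≠ 0 := sub_ne_zero.mpr (hQ _ (by omega)).symm
    have n3 : 1 - Q ^ (2 * n + 1) ≠ 0 := sub_ne_zero.mpr (hQ _ (by omega)).symm
    have n4 : 1 - Q ^ (s + 2 * n + 1) ≠ 0 := sub_ne_zero.mpr (hQ _ (by omega)).symm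
    have n5 : 1 - Q ^ (s + 2 * n + 2) ≠ 0 := sub_ne_zero.mpr (hQ _ (by omega)).symm
    have n6 := qShifted_sq_sq_ne_zero hQ (n + s)
    have hb : qShifted (Q ^ 2) (Q ^ 2) (n + 1 + s) =
        qShifted (Q ^ 2) (Q ^ 2) (n + s) * (1 - Q ^ (2 * s + 2 * n + 2)) := by
      rw [show n + 1 + s = n + s + 1 by ring, qShifted_succ, ← pow_mul, ← pow_add]
      ring_nf
    have hα : qShifted Q (Q ^ 2) (n + 1) = qShifted Q (Q ^ 2) n * (1 - Q ^ (2 * n + 1)) := by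
      rw [qShifted_succ, ← pow_mul, ← pow_succ']
    have hs : qShifted (Q ^ (s + (2 * n + 2)))⁻¹ Q s * qShifted (Q ^ (s + (2 * n + 2)) * Q) Q s *
          ((1 - Q ^ (2 * n + 1)) * (1 - Q ^ (2 * n + 2))) * Q ^ (2 * s) =
        qShifted (Q ^ (s + 2 * n))⁻¹ Q s * qShifted (Q ^ (s + 2 * n) * Q) Q s *
          ((1 - Q ^ (2 * s + 2 * n + 1)) * (1 - Q ^ (2 * s + 2 * n + 2))) := by
      have hl := qShifted_shift_two (Q ^ (s + (2 * n + 2)))⁻¹ Q s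
      have hr := qShifted_shift_two (Q ^ (s + 2 * n) * Q) Q s
      have hz : Q ^ (s + (2 * n + 2)) ≠ 0 := pow_ne_zero _ hQ0
      have x1 : (Q ^ (s + (2 * n + 2)))⁻¹ * Q * Q = (Q ^ (s + 2 * n))⁻¹ := by
        rw [show s + (2 * n + 2) = s + 2 * n + 2 by ring, pow_add _ (s + 2 * n)]
        field_simp
      have x2 : Q ^ (s + 2 * n) * Q * Q * Q = Q ^ (s + (2 * n + 2)) * Q := by ring
      rw [x1] at hl
      rw [x2] at hr
      have z1 : (1 - (Q ^ (s + (2 * n + 2)))⁻¹) * (1 - (Q ^ (s + (2 * n + 2)))⁻¹ * Q) *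
          (Q ^ (s + 2 * n + 2) * Q ^ (s + 2 * n + 1)) =
            (1 - Q ^ (s + 2 * n + 2)) * (1 - Q ^ (s + 2 * n + 1)) := by
        rw [show s + (2 * n + 2) = s + 2 * n + 2 by ring]
        simp only [pow_add, pow_mul, pow_one]
        field_simp
        ring
      have z2 : (1 - (Q ^ (s + (2 * n + 2)))⁻¹ * Q ^ s) *
          (1 - (Q ^ (s + (2 * n + 2)))⁻¹ * Q * Q ^ s) *
          (Q ^ (s + 2 * n + 2) * Q ^ (s + 2 * n + 1)) =
            (1 - Q ^ (2 * n + 2)) * (1 - Q ^ (2 * n + 1)) * Q ^ (2 * s) := by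
        rw [show s + (2 * n + 2) = s + 2 * n + 2 by ring]
        simp only [pow_add, pow_mul, pow_one]
        field_simp
        ring
      have hl' : (1 - Q ^ (s + 2 * n + 2)) * (1 - Q ^ (s + 2 * n + 1)) *
          qShifted (Q ^ (s + 2 * n))⁻¹ Q s = qShifted (Q ^ (s + (2 * n + 2)))⁻¹ Q s *
            ((1 - Q ^ (2 * n + 2)) * (1 - Q ^ (2 * n + 1)) * Q ^ (2 * s)) := by
        rw [← z1, ← z2]
        linear_combination (Q ^ (s + 2 * n + 2) * Q ^ (s + 2 * n + 1)) * hl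
      have x3 : Q ^ (s + 2 * n) * Q * Q ^ s = Q ^ (2 * s + 2 * n + 1) := by ring
      have x4 : Q ^ (s + 2 * n) * Q * Q * Q ^ s = Q ^ (2 * s + 2 * n + 2) := by ring
      rw [x3, x4] at hr
      have hr' : (1 - Q ^ (s + 2 * n + 1)) * (1 - Q ^ (s + 2 * n + 2)) *
          qShifted (Q ^ (s + (2 * n + 2)) * Q) Q s = qShifted (Q ^ (s + 2 * n) * Q) Q s *
            ((1 - Q ^ (2 * s + 2 * n + 1)) * (1 - Q ^ (2 * s + 2 * n + 2))) := by
        rw [← hr]; ring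
      apply mul_right_cancel₀ (mul_ne_zero n4 n5)
      linear_combination
        (qShifted (Q ^ (s + (2 * n + 2)))⁻¹ Q s *
            ((1 - Q ^ (2 * n + 2)) * (1 - Q ^ (2 * n + 1)) * Q ^ (2 * s))) * hr' -
        (qShifted (Q ^ (s + 2 * n) * Q) Q s *
            ((1 - Q ^ (2 * s + 2 * n + 1)) * (1 - Q ^ (2 * s + 2 * n + 2)))) * hl'
    rw [show 2 * (n + 1) = 2 * n + 2 by ring, hb, hα]
    apply mul_left_cancel₀ (mul_ne_zero n1 n2)
    rw [h]
    have he : Q ^ (s + (2 * s + 1) * (n + 1)) = Q ^ (s + (2 * s + 1) * n) * Q ^ (2 * s) * Q := by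
      ring
    rw [he]
    generalize qShifted (Q ^ (s + 2 * n))⁻¹ Q s * qShifted (Q ^ (s + 2 * n) * Q) Q s = W at *
    generalize qShifted (Q ^ (s + (2 * n + 2)))⁻¹ Q s *
      qShifted (Q ^ (s + (2 * n + 2)) * Q) Q s = W' at *
    generalize 1 - Q ^ (2 * n + 2) = u2 at *
    generalize 1 - Q ^ (2 * n + 1) = u1 at *
    generalize 1 - Q ^ (2 * s + 2 * n + 2) = v2 at *
    generalize 1 - Q ^ (2 * s + 2 * n + 1) = v1 at *
    generalize Q ^ (2 * s) = x at *
    field_simp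
    linear_combination -qShifted Q (Q ^ 2) n ^ 2 * hs

end WatsonEval

/-! ### Reflection of `q`-shifted factorials at a root of unity -/

section Reflection

variable {R : Type*} [CommRing R]

/-- Reflection `j ↦ p - j` turns the even factors `1 - ω ^ j` into odd ones if `ω ^ p = 1`. -/
lemma pow_mul_prod_even_mul_prod_odd {ω : R} {a n : ℕ} (hω : ω ^ (2 * a + 2 * n + 1) = 1) :
    ω ^ (n ^ 2 + 2 * a * n) *
        ((∏ i ∈ Finset.range a, (1 - ω ^ (2 * i + 1))) *
          ∏ i ∈ Finset.range n, (1 - ω ^ (2 * (i + 1)))) =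
      (-1) ^ n * ∏ i ∈ Finset.range (a + n), (1 - ω ^ (2 * i + 1)) := by
  have hpow : ω ^ (n ^ 2 + 2 * a * n) = ∏ i ∈ Finset.range n, ω ^ (2 * (a + i) + 1) := by
    rw [Finset.prod_pow_eq_pow_sum]
    congr 1
    clear hω
    induction n with
    | zero => simp
    | succ n ih => rw [Finset.sum_range_succ, ← ih]; ring
  have hsign : (-1 : R) ^ n = ∏ i ∈ Finset.range n, (-1 : R) := by simp
  rw [Finset.prod_range_add, hpow, hsign, mul_left_comm, mul_left_comm _ (∏ i ∈ Finset.range a, _),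
    ← Finset.prod_range_reflect (fun i => 1 - ω ^ (2 * (i + 1))), ← Finset.prod_mul_distrib,
    ← Finset.prod_mul_distrib]
  congr 1
  refine Finset.prod_congr rfl fun i hi => ?_
  have hi := Finset.mem_range.mp hi
  rw [mul_sub, ← pow_add,
    show 2 * (a + i) + 1 + 2 * (n - 1 - i + 1) = 2 * a + 2 * n + 1 by omega, hω]
  ring

/-- The congruence that puts the closed form of the terminating sum into its symmetric shape,
stated at an element `ω` with `ω ^ p = 1`, where `p = 2 a + 2 b + 2 s + 1`. -/
lemma pow_mul_prod_reflect {ω : R} {a b s : ℕ} (hω : ω ^ (2 * a + 2 * b + 2 * s + 1) = 1) :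
    ω ^ (s + (2 * s + 1) * a) *
        ((∏ i ∈ Finset.range a, (1 - ω ^ (2 * i + 1))) *
          ∏ i ∈ Finset.range (b + s), (1 - ω ^ (2 * (i + 1)))) =
      (-1) ^ (a + b) *
        ω ^ (a ^ 2 + b ^ 2 + 2 * a * b + 2 * a * s + 2 * b * s + a + b + s) *
        ((∏ i ∈ Finset.range b, (1 - ω ^ (2 * i + 1))) *
          ∏ i ∈ Finset.range (a + s), (1 - ω ^ (2 * (i + 1)))) := by
  have h1 := pow_mul_prod_even_mul_prod_odd (ω := ω) (a := a) (n := b + s) (by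
    rw [← hω]; ring)
  have h2 := pow_mul_prod_even_mul_prod_odd (ω := ω) (a := b) (n := a + s) (by
    rw [← hω]; ring)
  rw [show b + (a + s) = a + (b + s) by ring] at h2
  have hu : IsUnit ω := IsUnit.of_mul_eq_one (ω ^ (2 * a + 2 * b + 2 * s)) (by
    rw [← pow_succ', hω])
  have hexp : ω ^ ((b + s) ^ 2 + 2 * a * (b + s)) *
      ω ^ (a ^ 2 + b ^ 2 + 2 * a * b + 2 * a * s + 2 * b * s + a + b + s) =
      ω ^ ((a + s) ^ 2 + 2 * b * (a + s)) * ω ^ (s + (2 * s + 1) * a) := by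
    rw [← pow_add, ← pow_add, show (b + s) ^ 2 + 2 * a * (b + s) +
      (a ^ 2 + b ^ 2 + 2 * a * b + 2 * a * s + 2 * b * s + a + b + s) =
      (a + s) ^ 2 + 2 * b * (a + s) + (s + (2 * s + 1) * a) +
        (2 * a + 2 * b + 2 * s + 1) * b by ring, pow_add _ _ ((2 * a + 2 * b + 2 * s + 1) * b),
      pow_mul, hω, one_pow, mul_one]
  have hsign : (-1 : R) ^ (b + s) = (-1) ^ (a + b) * (-1) ^ (a + s) := by
    rw [← pow_add, show a + b + (a + s) = b + s + 2 * a by ring, pow_add _ (b + s), pow_mul]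
    simp
  apply ((hu.pow ((b + s) ^ 2 + 2 * a * (b + s))).mul
    (hu.pow ((a + s) ^ 2 + 2 * b * (a + s)))).mul_left_cancel
  generalize ω ^ ((b + s) ^ 2 + 2 * a * (b + s)) = U at *
  generalize ω ^ ((a + s) ^ 2 + 2 * b * (a + s)) = W at *
  generalize ω ^ (s + (2 * s + 1) * a) = E1 at *
  generalize ω ^ (a ^ 2 + b ^ 2 + 2 * a * b + 2 * a * s + 2 * b * s + a + b + s) = E2 at *
  generalize (∏ i ∈ Finset.range a, (1 - ω ^ (2 * i + 1))) *
          ∏ i ∈ Finset.range (b + s), (1 - ω ^ (2 * (i + 1))) = X at *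
  generalize (∏ i ∈ Finset.range b, (1 - ω ^ (2 * i + 1))) *
          ∏ i ∈ Finset.range (a + s), (1 - ω ^ (2 * (i + 1))) = Y at *
  generalize ∏ i ∈ Finset.range (a + (b + s)), (1 - ω ^ (2 * i + 1)) = G at *
  rw [hsign] at h1
  linear_combination W * E1 * h1 - (-1) ^ (a + b) * U * E2 * h2 -
    (-1) ^ (a + b) * (-1) ^ (a + s) * G * hexp

end Reflection

/-! ### Polynomials with integral coefficients over a valued field -/

section Valuation

variable {K : Type*} [Field K] {Γ : Type*} [LinearOrderedCommGroupWithZero Γ]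
  (v : Valuation K Γ)

lemma valuation_qShifted_le_one {a b : K} (ha : v a ≤ 1) (hb : v b ≤ 1) (n : ℕ) :
    v (qShifted a b n) ≤ 1 := by
  rw [qShifted, map_prod]
  refine Finset.prod_le_one' fun i _ => (v.map_sub _ _).trans (max_le (by simp) ?_)
  rw [map_mul, map_pow]
  exact mul_le_one' ha (pow_le_one' hb i)

lemma valuation_qShifted_sub_le {a a' b : K} (ha : v a ≤ 1) (ha' : v a' ≤ 1) (hb : v b ≤ 1)
    {γ : Γ} (h : v (a - a') ≤ γ) (n : ℕ) : v (qShifted a b n - qShifted a' b n) ≤ γ := by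
  induction n with
  | zero => simp [qShifted_zero]
  | succ n ih =>
    have e : qShifted a b (n + 1) - qShifted a' b (n + 1) =
        (qShifted a b n - qShifted a' b n) * (1 - a * b ^ n) -
          qShifted a' b n * b ^ n * (a - a') := by
      rw [qShifted_succ, qShifted_succ]; ring
    have hb' : v (b ^ n) ≤ 1 := by rw [map_pow]; exact pow_le_one' hb n
    rw [e]
    refine (v.map_sub _ _).trans (max_le ?_ ?_)
    · rw [map_mul]
      refine mul_le_of_le_of_le_one ih ((v.map_sub _ _).trans (max_le (by simp) ?_))
      rw [map_mul]
      exact mul_le_one' ha hb'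
    · rw [map_mul, map_mul]
      exact mul_le_of_le_one_of_le
        (mul_le_one' (valuation_qShifted_le_one v ha' hb n) hb') h

/-- Values of a polynomial with integral coefficients at congruent points are congruent. -/
lemma valuation_eval_sub_le (P : v.integer[X]) (x y : v.integer) :
    v (((P.eval x : v.integer) : K) - (P.eval y : v.integer)) ≤ v ((x : K) - y) := by
  obtain ⟨c, hc⟩ := P.sub_dvd_eval_sub x y
  have h := congrArg (fun z : v.integer => v (z : K)) hc
  simp only [AddSubgroupClass.coe_sub, Subring.coe_mul, map_mul] at h
  rw [h]
  exact mul_le_of_le_of_le_one le_rfl c.2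

/-- A polynomial with integral coefficients is divisible by the product over two distinct roots. -/
lemma valuation_eval_le_of_two_roots (P : v.integer[X]) {x y : v.integer} (hxy : x ≠ y)
    (hx : P.eval x = 0) (hy : P.eval y = 0) (z : v.integer) :
    v ((P.eval z : v.integer) : K) ≤ v ((z : K) - x) * v ((z : K) - y) := by
  obtain ⟨H, rfl⟩ := dvd_iff_isRoot.mpr hx
  have hH : H.eval y = 0 := by
    rw [eval_mul] at hy
    refine (mul_eq_zero.mp hy).resolve_left ?_
    simpa using sub_ne_zero.mpr hxy.symm
  obtain ⟨G, rfl⟩ := dvd_iff_isRoot.mpr hH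
  simp only [eval_mul, eval_sub, eval_X, eval_C, Subring.coe_mul, AddSubgroupClass.coe_sub, map_mul]
  rw [← mul_assoc]
  exact mul_le_of_le_of_le_one le_rfl (G.eval z).2

end Valuation

/-! ### The `[p]`-adic valuation on `ℚ(q)` -/

noncomputable section Adic

open IsDedekindDomain WithZero

lemma qInteger_eq_cyclotomic (p : ℕ) [Fact p.Prime] : qInteger p = cyclotomic p ℚ :=
  (cyclotomic_prime ℚ p).symm

lemma qInteger_irreducible (p : ℕ) [hp : Fact p.Prime] : Irreducible (qInteger p) := by
  rw [qInteger_eq_cyclotomic]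
  exact cyclotomic.irreducible_rat hp.out.pos

/-- The prime ideal of `ℚ[q]` generated by `[p]`. -/
def qIntegerPrime (p : ℕ) [Fact p.Prime] : HeightOneSpectrum ℚ[X] where
  asIdeal := Ideal.span {qInteger p}
  isPrime := (Ideal.span_singleton_prime (qInteger_irreducible p).ne_zero).mpr
    (qInteger_irreducible p).prime
  ne_bot := by simpa using (qInteger_irreducible p).ne_zero

/-- The `[p]`-adic valuation on `ℚ(q)`. -/
abbrev qVal (p : ℕ) [Fact p.Prime] : Valuation (RatFunc ℚ) ℤᵐ⁰ :=
  (qIntegerPrime p).valuation (RatFunc ℚ)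

variable (p : ℕ) [Fact p.Prime]

lemma qVal_algebraMap_le_iff (f : ℚ[X]) (n : ℕ) :
    qVal p (algebraMap ℚ[X] (RatFunc ℚ) f) ≤ exp (-(n : ℤ)) ↔ qInteger p ^ n ∣ f := by
  rw [HeightOneSpectrum.valuation_of_algebraMap, HeightOneSpectrum.intValuation_le_pow_iff_mem,
    qIntegerPrime, Ideal.span_singleton_pow, Ideal.mem_span_singleton]

lemma qVal_algebraMap_eq_one_iff (f : ℚ[X]) :
    qVal p (algebraMap ℚ[X] (RatFunc ℚ) f) = 1 ↔ ¬ qInteger p ∣ f := by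
  rw [HeightOneSpectrum.valuation_eq_one_iff_notMem, qIntegerPrime, Ideal.mem_span_singleton]

/-- Congruence modulo `[p] ^ n` is a bound on the `[p]`-adic valuation of the difference. -/
lemma ratFuncModEq_of_qVal_le {f g : RatFunc ℚ} {n : ℕ}
    (h : qVal p (f - g) ≤ exp (-(n : ℤ))) : RatFuncModEq (qInteger p ^ n) f g := by
  have hle : qVal p (f - g) ≤ 1 := h.trans (by rw [← exp_zero, exp_le_exp]; omega)
  have hd0 : algebraMap ℚ[X] (RatFunc ℚ) (f - g).denom ≠ 0 := by
    simpa using (f - g).denom_ne_zero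
  have hfrac := (f - g).num_div_denom
  have hnum : algebraMap ℚ[X] (RatFunc ℚ) (f - g).num =
      (f - g) * algebraMap ℚ[X] (RatFunc ℚ) (f - g).denom := by
    rw [← div_eq_iff hd0, hfrac]
  have hden : ¬ qInteger p ∣ (f - g).denom := by
    intro hdvd
    have h1 : qVal p (algebraMap ℚ[X] (RatFunc ℚ) (f - g).denom) ≤ exp (-((1 : ℕ) : ℤ)) :=
      (qVal_algebraMap_le_iff p _ 1).mpr (by simpa using hdvd)
    have h2 : qVal p (algebraMap ℚ[X] (RatFunc ℚ) (f - g).num) ≤ exp (-((1 : ℕ) : ℤ)) := by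
      rw [hnum, map_mul]
      exact mul_le_of_le_one_of_le hle h1
    rw [qVal_algebraMap_le_iff, pow_one] at h2
    exact (qInteger_irreducible p).not_isUnit
      ((f - g).isCoprime_num_denom.isUnit_of_dvd' h2 hdvd)
  have hn : qInteger p ^ n ∣ (f - g).num := by
    rw [← qVal_algebraMap_le_iff, hnum, map_mul, (qVal_algebraMap_eq_one_iff p _).mpr hden, mul_one]
    exact h
  obtain ⟨u, hu⟩ := hn
  refine ⟨u, (f - g).denom, ?_, ?_⟩
  · exact (((qInteger_irreducible p).coprime_iff_not_dvd.mpr hden).symm).pow_right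
  · rw [← hu, hfrac]

lemma qPow_eq_algebraMap (n : ℕ) : qPow n = algebraMap ℚ[X] (RatFunc ℚ) (X ^ n) := by
  simp [qPow]

lemma qPow_add (a b : ℤ) : qPow (a + b) = qPow a * qPow b :=
  zpow_add₀ RatFunc.X_ne_zero a b

lemma qPow_neg (a : ℤ) : qPow (-a) = (qPow a)⁻¹ := zpow_neg _ a

lemma qPow_mul_nat (a : ℤ) (n : ℕ) : qPow (a * n) = qPow a ^ n := by
  rw [qPow, zpow_mul, zpow_natCast, qPow]

lemma qPow_zero : qPow 0 = 1 := zpow_zero _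

lemma qPow_ne_zero (a : ℤ) : qPow a ≠ 0 := zpow_ne_zero _ RatFunc.X_ne_zero

lemma qInteger_dvd_X_pow_sub_one_iff (n : ℕ) : qInteger p ∣ X ^ n - 1 ↔ p ∣ n := by
  have hp : p.Prime := Fact.out
  constructor
  · intro h
    have hζ := Complex.isPrimitiveRoot_exp p hp.ne_zero
    rw [← hζ.pow_eq_one_iff_dvd]
    have hroot : aeval (Complex.exp (2 * Real.pi * Complex.I / p)) (qInteger p) = 0 := by
      rw [qInteger_eq_cyclotomic, aeval_def, eval₂_eq_eval_map, map_cyclotomic]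
      exact hζ.isRoot_cyclotomic hp.pos
    have h2 := aeval_eq_zero_of_dvd_aeval_eq_zero h hroot
    simpa [sub_eq_zero] using h2
  · rintro ⟨k, rfl⟩
    rw [pow_mul]
    refine dvd_trans ⟨X - 1, ?_⟩ (sub_one_dvd_pow_sub_one _ k)
    rw [qInteger_eq_cyclotomic, cyclotomic_prime_mul_X_sub_one]

lemma qVal_qPow (e : ℤ) : qVal p (qPow e) = 1 := by
  have hX : qVal p RatFunc.X = 1 := by
    rw [← RatFunc.algebraMap_X, qVal_algebraMap_eq_one_iff]
    intro h
    have h1 := (qInteger_dvd_X_pow_sub_one_iff p p).mpr dvd_rfl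
    have h2 : qInteger p ∣ X ^ p := dvd_pow h (Fact.out : p.Prime).ne_zero
    have h3 := dvd_sub h2 h1
    rw [sub_sub_cancel] at h3
    exact (qInteger_irreducible p).not_isUnit (isUnit_of_dvd_one h3)
  rw [qPow, map_zpow₀, hX, one_zpow]

lemma qVal_one_sub_qPow_nat (n : ℕ) :
    qVal p (1 - qPow n) = qVal p (algebraMap ℚ[X] (RatFunc ℚ) (X ^ n - 1)) := by
  rw [Valuation.map_sub_swap, (algebraMap ℚ[X] (RatFunc ℚ)).map_sub,
    (algebraMap ℚ[X] (RatFunc ℚ)).map_one, qPow_eq_algebraMap]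

lemma qVal_one_sub_qPow_neg (e : ℤ) : qVal p (1 - qPow (-e)) = qVal p (1 - qPow e) := by
  have h : 1 - qPow (-e) = -(qPow (-e) * (1 - qPow e)) := by
    rw [mul_sub, ← qPow_add, neg_add_cancel, qPow_zero]; ring
  rw [h, Valuation.map_neg, map_mul, qVal_qPow, one_mul]

lemma qVal_one_sub_qPow_of_not_dvd {e : ℤ} (h : ¬ (p : ℤ) ∣ e) : qVal p (1 - qPow e) = 1 := by
  obtain ⟨n, rfl | rfl⟩ := e.eq_nat_or_neg
  · rw [qVal_one_sub_qPow_nat, qVal_algebraMap_eq_one_iff, qInteger_dvd_X_pow_sub_one_iff]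
    exact_mod_cast h
  · rw [qVal_one_sub_qPow_neg, qVal_one_sub_qPow_nat, qVal_algebraMap_eq_one_iff,
      qInteger_dvd_X_pow_sub_one_iff]
    rw [dvd_neg] at h
    exact_mod_cast h

lemma qVal_one_sub_qPow_le {e : ℤ} (h : (p : ℤ) ∣ e) : qVal p (1 - qPow e) ≤ exp (-1) := by
  have key : ∀ n : ℕ, p ∣ n → qVal p (1 - qPow n) ≤ exp (-1) := fun n hn => by
    rw [qVal_one_sub_qPow_nat]
    exact (qVal_algebraMap_le_iff p _ 1).mpr
      (by rw [pow_one]; exact (qInteger_dvd_X_pow_sub_one_iff p n).mpr hn)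
  obtain ⟨n, rfl | rfl⟩ := e.eq_nat_or_neg
  · exact key n (by exact_mod_cast h)
  · rw [qVal_one_sub_qPow_neg]
    rw [dvd_neg] at h
    exact key n (by exact_mod_cast h)

lemma qVal_one_sub_qPow_le_one (e : ℤ) : qVal p (1 - qPow e) ≤ 1 :=
  (Valuation.map_sub _ _ _).trans (by simp [qVal_qPow])

lemma qPow_eq_one_iff (e : ℤ) : qPow e = 1 ↔ e = 0 := by
  refine ⟨fun h => ?_, fun h => by rw [h, qPow_zero]⟩
  have key : ∀ n : ℕ, qPow n = 1 → n = 0 := fun n hn => by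
    rw [qPow_eq_algebraMap, ← map_one (algebraMap ℚ[X] (RatFunc ℚ))] at hn
    have := congrArg natDegree (RatFunc.algebraMap_injective ℚ hn)
    simpa using this
  obtain ⟨n, rfl | rfl⟩ := e.eq_nat_or_neg
  · exact_mod_cast key n h
  · rw [qPow_neg, inv_eq_one] at h
    simp [key n h]

end Adic

/-! ### Divisibility of the summands -/

noncomputable section Summands

open IsDedekindDomain WithZero

variable (p : ℕ) [Fact p.Prime]

lemma qShifted_qPow (a b : ℤ) (n : ℕ) :
    qShifted (qPow a) (qPow b) n = ∏ i ∈ Finset.range n, (1 - qPow (a + b * i)) := by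
  simp only [qShifted, qPow_add, qPow_mul_nat]

lemma qVal_qShifted_le_one (a b : ℤ) (n : ℕ) : qVal p (qShifted (qPow a) (qPow b) n) ≤ 1 :=
  valuation_qShifted_le_one _ (qVal_qPow p a).le (qVal_qPow p b).le n

lemma qVal_qShifted_le {a b : ℤ} {n i : ℕ} (hi : i < n) (h : (p : ℤ) ∣ a + b * i) :
    qVal p (qShifted (qPow a) (qPow b) n) ≤ exp (-1) := by
  rw [qShifted_qPow, map_prod, ← Finset.mul_prod_erase _ _ (Finset.mem_range.mpr hi)]
  exact mul_le_of_le_of_le_one (qVal_one_sub_qPow_le p h)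
    (Finset.prod_le_one' fun j _ => qVal_one_sub_qPow_le_one p _)

lemma qVal_qShifted_eq_one {a b : ℤ} {n : ℕ} (h : ∀ i < n, ¬ (p : ℤ) ∣ a + b * i) :
    qVal p (qShifted (qPow a) (qPow b) n) = 1 := by
  rw [qShifted_qPow, map_prod]
  exact Finset.prod_eq_one fun i hi =>
    qVal_one_sub_qPow_of_not_dvd p (h i (Finset.mem_range.mp hi))

lemma qVal_qShifted_self_eq_one {e : ℤ} (he : ¬ (p : ℤ) ∣ e) {n : ℕ} (hn : n < p) :
    qVal p (qShifted (qPow e) (qPow e) n) = 1 := by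
  refine qVal_qShifted_eq_one p fun i hi hd => ?_
  have hp : Prime (p : ℤ) := Nat.prime_iff_prime_int.mp Fact.out
  rw [show e + e * i = e * ((i + 1 : ℕ) : ℤ) by push_cast; ring] at hd
  have h2 := (hp.dvd_or_dvd hd).resolve_left he
  have := Nat.le_of_dvd i.succ_pos (by exact_mod_cast h2)
  omega

lemma qShifted_add {K : Type*} [Field K] (a b : K) (n l : ℕ) :
    qShifted a b (n + l) = qShifted a b n * qShifted (a * b ^ n) b l := by
  simp only [qShifted, Finset.prod_range_add, pow_add, mul_assoc]

lemma qPow_pow_ne_one {m : ℕ} (hm : 0 < m) (j : ℕ) (hj : 0 < j) : qPow m ^ j ≠ 1 := by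
  rw [← qPow_mul_nat, Ne, qPow_eq_one_iff]
  positivity

lemma qPow_two_mul (e : ℤ) : qPow (2 * e) = qPow e ^ 2 := by
  rw [mul_comm]; exact_mod_cast qPow_mul_nat e 2

lemma qSummand_eq (m r s j : ℕ) :
    qSummand m r s (s + j) = watsonCoeff (qPow m) s j *
      (qShifted (qPow r) (qPow m) (s + j) * qShifted (qPow ((m : ℤ) - r)) (qPow m) (s + j)) := by
  rw [qSummand, watsonCoeff, show s + j - s = j by omega, show s + j + s = 2 * s + j by ring,
    qPow_two_mul, qPow_mul_nat]
  ring

lemma not_dvd_two_mul {m : ℕ} (hodd : Odd p) (hpm : ¬ p ∣ m) : ¬ (p : ℤ) ∣ 2 * m := by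
  have hp : p.Prime := Fact.out
  intro h
  have h' : p ∣ 2 * m := by exact_mod_cast h
  rcases hp.dvd_mul.mp h' with h2 | h2
  · have := Nat.le_of_dvd two_pos h2
    have := hp.two_le
    obtain ⟨t, ht⟩ := hodd
    omega
  · exact hpm h2

/-- The summands beyond `(p - 1) / 2` are divisible by `[p] ^ 2`. If `k + s < p`, one factor
`[p]` comes from `(q ^ m; q ^ m)_{2 k}` and one from the shifted factorial whose residue is the
smaller one; if `k + s ≥ p`, then `k` exceeds both residues. -/
lemma qVal_qSummand_le {m r A B s k : ℕ} (hm : 0 < m) (hodd : Odd p) (hpm : ¬ p ∣ m)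
    (hA : (p : ℤ) ∣ r + m * A) (hB : (p : ℤ) ∣ (m - r) + m * B) (hAB : A + B + 1 = p)
    (hsA : s ≤ A) (hsB : s ≤ B) (hk : p < 2 * k) (hkp : k < p) :
    qVal p (qSummand m r s k) ≤ exp (-2) := by
  have hpm' : ¬ (p : ℤ) ∣ m := by exact_mod_cast hpm
  have hpm2 := not_dvd_two_mul p hodd hpm
  have hQ := qPow_pow_ne_one hm
  have hsplit : qShifted (qPow m) (qPow m) (2 * k) = qShifted (qPow m) (qPow m) (k + s) *
      qShifted (qPow (m + m * (k + s : ℕ))) (qPow m) (k - s) := by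
    rw [show 2 * k = k + s + (k - s) by omega, qShifted_add, qPow_add, qPow_mul_nat]
  have h0 := qShifted_self_ne_zero hQ (k + s)
  have hform : qSummand m r s k = qShifted (qPow (m + m * (k + s : ℕ))) (qPow m) (k - s) *
      (qShifted (qPow r) (qPow m) k * qShifted (qPow ((m : ℤ) - r)) (qPow m) k) * qPow (m * k) /
      (qShifted (qPow m) (qPow m) (k - s) * qShifted (qPow (2 * m)) (qPow (2 * m)) k ^ 2) := by
    have h1 := qShifted_self_ne_zero hQ (k - s)
    have h2 : qShifted (qPow (2 * m)) (qPow (2 * m)) k ≠ 0 := by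
      rw [qPow_two_mul]; exact qShifted_sq_sq_ne_zero hQ k
    rw [qSummand, hsplit]
    field_simp
  rw [hform, map_div₀, map_mul, map_mul, map_mul, map_mul, map_pow, qVal_qPow,
    qVal_qShifted_self_eq_one p hpm' (by omega : k - s < p),
    qVal_qShifted_self_eq_one p hpm2 hkp]
  simp only [one_pow, mul_one, div_one]
  have hr1 := qVal_qShifted_le_one p r m k
  have hr2 := qVal_qShifted_le_one p ((m : ℤ) - r) m k
  have hexp : (exp (-2) : ℤᵐ⁰) = exp (-1) * exp (-1) := by rw [← exp_add]; rfl
  rw [hexp]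
  by_cases hks : k + s < p
  · refine mul_le_mul' (qVal_qShifted_le p (i := p - (k + s) - 1) (by omega) ?_) ?_
    · refine ⟨m, ?_⟩
      have : ((p - (k + s) - 1 : ℕ) : ℤ) = p - (k + s) - 1 := by omega
      rw [this]; push_cast; ring
    · by_cases hAk : A < k
      · exact mul_le_of_le_of_le_one (qVal_qShifted_le p hAk hA) hr2
      · exact mul_le_of_le_one_of_le hr1 (qVal_qShifted_le p (by omega : B < k) hB)
  · exact mul_le_of_le_one_of_le (qVal_qShifted_le_one p _ _ _)
      (mul_le_mul' (qVal_qShifted_le p (by omega) hA) (qVal_qShifted_le p (by omega) hB))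

/-- The coefficients of the sum are `[p]`-integral as long as `k + s < p`. -/
lemma qVal_watsonCoeff_le_one {m s j : ℕ} (hodd : Odd p) (hpm : ¬ p ∣ m) (hj : 2 * s + j < p) :
    qVal p (watsonCoeff (qPow m) s j) ≤ 1 := by
  have hpm' : ¬ (p : ℤ) ∣ m := by exact_mod_cast hpm
  have hpm2 := not_dvd_two_mul p hodd hpm
  rw [watsonCoeff, ← qPow_two_mul, map_div₀, map_mul, map_mul, map_mul, map_pow, map_pow, qVal_qPow,
    qVal_qShifted_self_eq_one p hpm' (by omega : j < p),
    qVal_qShifted_self_eq_one p hpm' hj,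
    qVal_qShifted_self_eq_one p hpm2 (by omega : s + j < p)]
  simpa using qVal_qShifted_le_one p m m (2 * (s + j))

/-- Since `(1 - x Q ^ i) (1 - y Q ^ i) = 1 + Q ^ (2 i + 1) - Q ^ i (x + y)` when `x y = Q`, sums
of products `(x; Q)_k (y; Q)_k` are polynomials in `x + y`. -/
lemma exists_polynomial_eval_add {K : Type*} [Field K] {Γ : Type*}
    [LinearOrderedCommGroupWithZero Γ] (v : Valuation K Γ) {Q : K} (hQ : v Q ≤ 1) (s L : ℕ)
    {c : ℕ → K} (hc : ∀ j < L, v (c j) ≤ 1) :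
    ∃ P : v.integer[X], ∀ x y : K, x * y = Q → ∀ z : v.integer, (z : K) = x + y →
      ((P.eval z : v.integer) : K) =
        ∑ j ∈ Finset.range L, c j * (qShifted x Q (s + j) * qShifted y Q (s + j)) := by
  classical
  let c' : ℕ → v.integer := fun j => if h : v (c j) ≤ 1 then ⟨c j, h⟩ else 0
  let Q' : v.integer := ⟨Q, hQ⟩
  refine ⟨∑ j ∈ Finset.range L, C (c' j) *
    ∏ i ∈ Finset.range (s + j), (C (1 + Q' ^ (2 * i + 1)) - C (Q' ^ i) * X), ?_⟩
  intro x y hxy z hz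
  rw [eval_finsetSum, AddSubmonoidClass.coe_finsetSum]
  refine Finset.sum_congr rfl fun j hj => ?_
  have hcj : (c' j : K) = c j := by
    simp only [c', dif_pos (hc j (Finset.mem_range.mp hj))]
  rw [eval_mul, eval_C, eval_prod, Subring.coe_mul, hcj, SubmonoidClass.coe_finsetProd, qShifted,
    qShifted, ← Finset.prod_mul_distrib]
  congr 1
  refine Finset.prod_congr rfl fun i _ => ?_
  simp only [eval_sub, eval_C, eval_mul, eval_X, AddSubgroupClass.coe_sub, Subring.coe_add,
    Subring.coe_mul, Subring.coe_one, SubmonoidClass.coe_pow, hz, Q']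
  rw [pow_succ, pow_mul', ← hxy]
  ring

/-- The parameter `x + Q / x` at `x = q ^ ρ` and at `x = Q ^ (-C)`. -/
lemma qVal_parameter_sub (m C : ℕ) (ρ : ℤ) :
    qVal p (qPow ρ + qPow (m - ρ) - ((qPow m ^ C)⁻¹ + qPow m ^ C * qPow m)) =
      qVal p (1 - qPow (ρ + m * C)) * qVal p (1 - qPow (m - ρ + m * C)) := by
  have h : qPow ρ + qPow (m - ρ) - ((qPow m ^ C)⁻¹ + qPow m ^ C * qPow m) =
      -(qPow m ^ C)⁻¹ * ((1 - qPow (ρ + m * C)) * (1 - qPow (m - ρ + m * C))) := by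
    have h1 : qPow (ρ + m * C) = qPow ρ * qPow m ^ C := by rw [qPow_add, qPow_mul_nat]
    have h2 : qPow (m - ρ + m * C) = qPow (m - ρ) * qPow m ^ C := by rw [qPow_add, qPow_mul_nat]
    have h3 : qPow ρ * qPow (m - ρ) = qPow m := by rw [← qPow_add]; congr 1; ring
    have h4 := pow_ne_zero C (qPow_ne_zero m)
    rw [h1, h2]
    field_simp
    linear_combination (qPow m ^ C) ^ 2 * h3
  rw [h, map_mul, Valuation.map_neg, map_inv₀, map_pow, qVal_qPow, map_mul]
  simp

/-- The reflection congruence in `ℚ(q)`, with `Q = q ^ m`. -/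
lemma qVal_reflect_le (m : ℕ) {a b s : ℕ} (hp : 2 * a + 2 * b + 2 * s + 1 = p) :
    qVal p (qPow m ^ (s + (2 * s + 1) * a) *
        (qShifted (qPow m) (qPow m ^ 2) a * qShifted (qPow m ^ 2) (qPow m ^ 2) (b + s)) -
      (-1) ^ (a + b) *
        qPow m ^ (a ^ 2 + b ^ 2 + 2 * a * b + 2 * a * s + 2 * b * s + a + b + s) *
        (qShifted (qPow m) (qPow m ^ 2) b * qShifted (qPow m ^ 2) (qPow m ^ 2) (a + s))) ≤
      exp (-1) := by
  have hω : (Ideal.Quotient.mk (Ideal.span {qInteger p}) (X ^ m)) ^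
      (2 * a + 2 * b + 2 * s + 1) = 1 := by
    rw [hp, ← map_pow, ← pow_mul, ← map_one (Ideal.Quotient.mk (Ideal.span {qInteger p})),
      Ideal.Quotient.mk_eq_mk_iff_sub_mem, Ideal.mem_span_singleton,
      qInteger_dvd_X_pow_sub_one_iff]
    exact dvd_mul_left p m
  have h := pow_mul_prod_reflect hω
  simp only [← map_pow, ← map_one (Ideal.Quotient.mk (Ideal.span {qInteger p})), ← map_sub,
    ← map_prod, ← map_mul, ← map_neg] at h
  rw [Ideal.Quotient.mk_eq_mk_iff_sub_mem, Ideal.mem_span_singleton, ← pow_one (qInteger p),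
    ← qVal_algebraMap_le_iff] at h
  have e1 : ∀ n, qShifted (qPow m) (qPow m ^ 2) n =
      ∏ i ∈ Finset.range n, (1 - qPow m ^ (2 * i + 1)) := fun n => by
    simp only [qShifted, ← pow_mul, ← pow_succ']
  have e2 : ∀ n, qShifted (qPow m ^ 2) (qPow m ^ 2) n =
      ∏ i ∈ Finset.range n, (1 - qPow m ^ (2 * (i + 1))) := fun n => by
    simp only [qShifted, ← pow_mul, ← pow_add, mul_add, mul_one, add_comm]
  simp only [e1, e2]
  simp only [qPow_eq_algebraMap]
  rw [Nat.cast_one] at h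
  simpa only [map_sub, map_mul, map_prod, map_pow, map_neg, map_one] using h

end Summands

/-! ### The sums modulo `[p]` and `[p] ^ 2` -/

noncomputable section Main

open IsDedekindDomain WithZero

variable (p : ℕ) [Fact p.Prime]

lemma leastResidue_lt (a : ℚ) : leastResidue p a < p := ZMod.val_lt _

/-- The least residue of `-c / m` solves `c + m A ≡ 0` modulo `p`. -/
lemma dvd_add_mul_leastResidue {m : ℕ} (hpm : ¬ p ∣ m) (c : ℤ) :
    (p : ℤ) ∣ c + m * leastResidue p (-(c : ℚ) / m) := by
  have hm0 : ((m : ℤ) : ZMod p) ≠ 0 := by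
    rw [Int.cast_natCast, Ne, ZMod.natCast_eq_zero_iff]; exact hpm
  have h : ((-(c : ℚ) / m : ℚ) : ZMod p) = (-c : ℤ) / (m : ℤ) := by
    rw [← Rat.cast_divInt_of_ne_zero (-c) hm0, Rat.divInt_eq_div]
    push_cast
    rfl
  rw [← ZMod.intCast_zmod_eq_zero_iff_dvd]
  push_cast
  rw [leastResidue, ZMod.natCast_zmod_val, h]
  push_cast at hm0 ⊢
  field_simp
  ring

/-- All that the two cases share: up to a multiple of `[p] ^ 2`, the sums in question are the value
at `q ^ r + q ^ (m - r)` of a polynomial with `[p]`-integral coefficients, whose values at the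
parameters given by `A` and `B` are terminating sums. -/
lemma exists_polynomial_of_sum {m r A B s : ℕ} (hm : 0 < m) (hodd : Odd p) (hpm : ¬ p ∣ m)
    (hA : (p : ℤ) ∣ r + m * A) (hB : (p : ℤ) ∣ (m - r) + m * B) (hAB : A + B + 1 = p)
    (hsA : s ≤ A) (hsB : s ≤ B) :
    ∃ (P : (qVal p).integer[X]) (z : (qVal p).integer) (y : ℕ → (qVal p).integer),
      (z : RatFunc ℚ) = qPow r + qPow ((m : ℤ) - r) ∧
      (∀ C, (y C : RatFunc ℚ) = (qPow m ^ C)⁻¹ + qPow m ^ C * qPow m) ∧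
      (∀ C, ((P.eval (y C) : (qVal p).integer) : RatFunc ℚ) =
        ∑ j ∈ Finset.range (p - 2 * s), watsonTerm (qPow m) s (qPow m ^ C) j) ∧
      ∀ N, p < 2 * (N + 1) → N < p →
        qVal p (∑ k ∈ Finset.Icc s N, qSummand m r s k - (P.eval z : (qVal p).integer)) ≤
          exp (-2) := by
  obtain ⟨P, hP⟩ := exists_polynomial_eval_add (qVal p) (qVal_qPow p m).le s (p - 2 * s)
    (c := watsonCoeff (qPow m) s)
    (fun j hj => qVal_watsonCoeff_le_one p hodd hpm (by omega))
  have hQ (C : ℕ) : qVal p (qPow m ^ C) = 1 := by rw [map_pow, qVal_qPow, one_pow]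
  have hz : qVal p (qPow r + qPow ((m : ℤ) - r)) ≤ 1 :=
    (Valuation.map_add _ _ _).trans (by simp [qVal_qPow])
  have hy (C : ℕ) : qVal p ((qPow m ^ C)⁻¹ + qPow m ^ C * qPow m) ≤ 1 :=
    (Valuation.map_add _ _ _).trans (by rw [map_inv₀, map_mul, hQ, qVal_qPow]; simp)
  refine ⟨P, ⟨_, hz⟩, fun C => ⟨_, hy C⟩, rfl, fun _ => rfl, fun C => ?_, fun N hN hNp => ?_⟩
  · refine hP (qPow m ^ C)⁻¹ (qPow m ^ C * qPow m) ?_ ⟨_, hy C⟩ rfl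
    rw [inv_mul_cancel_left₀ (pow_ne_zero _ (qPow_ne_zero _))]
  · have hmul : qPow r * qPow ((m : ℤ) - r) = qPow m := by
      rw [← qPow_add]; congr 1; ring
    rw [hP _ _ hmul ⟨_, hz⟩ rfl]
    have hsum : ∑ j ∈ Finset.range (p - 2 * s), watsonCoeff (qPow m) s j *
        (qShifted (qPow r) (qPow m) (s + j) * qShifted (qPow ((m : ℤ) - r)) (qPow m) (s + j)) =
        ∑ k ∈ Finset.Ico s (p - s), qSummand m r s k := by
      rw [Finset.sum_Ico_eq_sum_range, show p - s - s = p - 2 * s by omega]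
      exact Finset.sum_congr rfl fun j _ => (qSummand_eq m r s j).symm
    have hIcc : Finset.Icc s N = Finset.Ico s (N + 1) := by ext; simp
    have tail : ∀ M N : ℕ, p < 2 * M → M ≤ N → N ≤ p →
        qVal p (∑ k ∈ Finset.Ico M N, qSummand m r s k) ≤ exp (-2) := fun M N hM _ hN =>
      Valuation.map_sum_le _ fun k hk => by
        rw [Finset.mem_Ico] at hk
        exact qVal_qSummand_le p hm hodd hpm hA hB hAB hsA hsB (by omega) (by omega)
    rw [hsum, hIcc]
    rcases le_total (N + 1) (p - s) with h | h
    · rw [Valuation.map_sub_swap, ← Finset.sum_Ico_consecutive _ (by omega : s ≤ N + 1) h,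
        add_sub_cancel_left]
      exact tail _ _ hN h (by omega)
    · rw [← Finset.sum_Ico_consecutive _ (by omega : s ≤ p - s) h, add_sub_cancel_left]
      exact tail _ _ (by omega) h (by omega)

/-- The case in which both terminating sums vanish: a polynomial with two roots that are congruent
to the evaluation point modulo `[p]` has a value divisible by `[p] ^ 2`. -/
lemma qVal_sum_le_of_odd {m r A B s : ℕ} (hm : 0 < m) (hodd : Odd p) (hpm : ¬ p ∣ m)
    (hA : (p : ℤ) ∣ r + m * A) (hB : (p : ℤ) ∣ (m - r) + m * B) (hAB : A + B + 1 = p)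
    (hsA : s ≤ A) (hsB : s ≤ B) (hpar : A % 2 = (s + 1) % 2) {N : ℕ} (hN : p < 2 * (N + 1))
    (hNp : N < p) : qVal p (∑ k ∈ Finset.Icc s N, qSummand m r s k) ≤ exp (-2) := by
  obtain ⟨P, z, y, hz, hy, hPy, hPz⟩ :=
    exists_polynomial_of_sum p hm hodd hpm hA hB hAB hsA hsB
  have hQ0 := qPow_ne_zero m
  have hQ := qPow_pow_ne_one hm
  have hroot : ∀ C, s ≤ C → C + s < p → C % 2 = (s + 1) % 2 → P.eval (y C) = 0 := by
    intro C h1 h2 h3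
    apply Subtype.ext
    obtain ⟨n, rfl⟩ := Nat.exists_eq_add_of_le h1
    rw [hPy]
    exact sum_watsonTerm_odd hQ0 hQ s n _ (Nat.odd_iff.mpr (by omega)) (by omega)
  have hexp : (exp (-2) : ℤᵐ⁰) = exp (-1) * exp (-1) := by rw [← exp_add]; rfl
  have hrA := hroot A hsA (by omega) hpar
  have hrB := hroot B hsB (by omega) (by obtain ⟨t, ht⟩ := hodd; omega)
  have hzA : qVal p (z - y A) ≤ exp (-1) := by
    rw [hz, hy, qVal_parameter_sub]
    exact mul_le_of_le_of_le_one (qVal_one_sub_qPow_le p hA) (qVal_one_sub_qPow_le_one p _)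
  have hzB : qVal p (z - y B) ≤ exp (-1) := by
    rw [hz, hy, qVal_parameter_sub]
    exact mul_le_of_le_one_of_le (qVal_one_sub_qPow_le_one p _) (qVal_one_sub_qPow_le p hB)
  have hval : qVal p ((P.eval z : (qVal p).integer) : RatFunc ℚ) ≤ exp (-2) := by
    by_cases hne : A = B
    · -- The two roots coincide, but then both factors of `z - y A` are divisible by `[p]`.
      subst hne
      have h := valuation_eval_sub_le (qVal p) P z (y A)
      rw [hrA, ZeroMemClass.coe_zero, sub_zero, hz, hy, qVal_parameter_sub] at h
      rw [hexp]
      exact h.trans (mul_le_mul' (qVal_one_sub_qPow_le p hA) (qVal_one_sub_qPow_le p hB))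
    · have hyne : y A ≠ y B := by
        intro h
        have h' := congrArg (fun x : (qVal p).integer => (x : RatFunc ℚ)) h
        simp only [hy] at h'
        have hA0 := pow_ne_zero A hQ0
        have hB0 := pow_ne_zero B hQ0
        have hmul : (qPow m ^ A - qPow m ^ B) * (1 - qPow m ^ (A + B + 1)) = 0 := by
          field_simp at h'
          rw [pow_succ, pow_add]
          linear_combination -h'
        rcases mul_eq_zero.mp hmul with h1 | h1
        · rw [sub_eq_zero, ← qPow_mul_nat, ← qPow_mul_nat] at h1
          have h2 : qPow ((m : ℤ) * A - m * B) = 1 := by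
            rw [sub_eq_add_neg, qPow_add, qPow_neg, h1, mul_inv_cancel₀ (qPow_ne_zero _)]
          rw [qPow_eq_one_iff, ← mul_sub] at h2
          rcases mul_eq_zero.mp h2 with h3 | h3 <;> omega
        · exact hQ _ (by omega) (sub_eq_zero.mp h1).symm
      rw [hexp]
      exact (valuation_eval_le_of_two_roots (qVal p) P hyne hrA hrB z).trans
        (mul_le_mul' hzA hzB)
  rw [← sub_add_cancel (∑ k ∈ Finset.Icc s N, qSummand m r s k)
    ((P.eval z : (qVal p).integer) : RatFunc ℚ)]
  exact (Valuation.map_add _ _ _).trans (max_le (hPz N hN hNp) hval)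

/-- The case in which the terminating sums have a closed form, with `A = s + 2 a` and
`B = s + 2 b`. -/
lemma qVal_sum_sub_le_of_even {m r a b s : ℕ} (hm : 0 < m) (hodd : Odd p) (hpm : ¬ p ∣ m)
    (hA : (p : ℤ) ∣ r + m * (s + 2 * a : ℕ)) (hB : (p : ℤ) ∣ (m - r) + m * (s + 2 * b : ℕ))
    (hAB : s + 2 * a + (s + 2 * b) + 1 = p) {N : ℕ} (hN : p < 2 * (N + 1)) (hNp : N < p) :
    qVal p (∑ k ∈ Finset.Icc s N, qSummand m r s k -
      (-1) ^ (a + b) *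
        qPow m ^ (a ^ 2 + b ^ 2 + 2 * a * b + 2 * a * s + 2 * b * s + a + b + s) *
        qShifted (qPow m) (qPow m ^ 2) a * qShifted (qPow m) (qPow m ^ 2) b *
        qShifted (qPow m ^ (s + 2 * a))⁻¹ (qPow m) s *
        qShifted (qPow m ^ (s + 2 * b))⁻¹ (qPow m) s /
      (qShifted (qPow m ^ 2) (qPow m ^ 2) (a + s) * qShifted (qPow m ^ 2) (qPow m ^ 2) (b + s))) ≤
      exp (-1) := by
  obtain ⟨P, z, y, hz, hy, hPy, hPz⟩ :=
    exists_polynomial_of_sum (s := s) p hm hodd hpm hA hB hAB (by omega) (by omega)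
  have hQ0 := qPow_ne_zero m
  have hQ := qPow_pow_ne_one hm
  have hle : (exp (-2) : ℤᵐ⁰) ≤ exp (-1) := by rw [exp_le_exp]; norm_num
  have hzA : qVal p ((P.eval z : (qVal p).integer) - (P.eval (y (s + 2 * a)) : (qVal p).integer)) ≤
      exp (-1) := by
    refine (valuation_eval_sub_le (qVal p) P z (y (s + 2 * a))).trans ?_
    rw [hz, hy, qVal_parameter_sub]
    exact mul_le_of_le_of_le_one (qVal_one_sub_qPow_le p hA) (qVal_one_sub_qPow_le_one p _)
  rw [hPy, sum_watsonTerm_even hQ0 hQ s a (p - 2 * s) (by omega)] at hzA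
  have hβ (n : ℕ) (hn : n < p) : qVal p (qShifted (qPow m ^ 2) (qPow m ^ 2) n) = 1 := by
    rw [← qPow_two_mul]
    exact qVal_qShifted_self_eq_one p (not_dvd_two_mul p hodd hpm) hn
  have hα (n : ℕ) : qVal p (qShifted (qPow m) (qPow m ^ 2) n) ≤ 1 := by
    rw [← qPow_two_mul]; exact qVal_qShifted_le_one p _ _ _
  have hQv (n : ℕ) : qVal p (qPow m ^ n) = 1 := by rw [map_pow, qVal_qPow, one_pow]
  have hneg (n : ℕ) : qVal p (qPow m ^ n)⁻¹ ≤ 1 := by rw [map_inv₀, hQv, inv_one]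
  have hpos (n : ℕ) : qVal p (qPow m ^ n * qPow m) ≤ 1 := by rw [map_mul, hQv, qVal_qPow, one_mul]
  -- `Q ^ (A + 1)` and `Q ^ (-B)` agree modulo `[p]` because `A + B + 1 = p`.
  have hshift := valuation_qShifted_sub_le (qVal p) (hpos (s + 2 * a)) (hneg (s + 2 * b))
    (qVal_qPow p m).le (γ := exp (-1)) (by
      have e : qPow m ^ (s + 2 * a) * qPow m - (qPow m ^ (s + 2 * b))⁻¹ =
          -((qPow m ^ (s + 2 * b))⁻¹ * (1 - qPow (m * p))) := by
        have h0 := pow_ne_zero (s + 2 * b) hQ0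
        rw [qPow_mul_nat, ← hAB]
        field_simp
        ring
      rw [e, Valuation.map_neg, map_mul]
      exact mul_le_of_le_one_of_le (hneg _) (qVal_one_sub_qPow_le p (dvd_mul_left _ _))) s
  have hrefl := qVal_reflect_le p m (a := a) (b := b) (s := s) (by omega)
  have h1 := qShifted_sq_sq_ne_zero hQ (a + s)
  have h2 := qShifted_sq_sq_ne_zero hQ (b + s)
  have hv1 := hβ (a + s) (by omega)
  have hv2 := hβ (b + s) (by omega)
  have hαa := hα a
  have hαb := hα b
  have hW := valuation_qShifted_le_one (qVal p) (hneg (s + 2 * a)) (qVal_qPow p m).le s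
  have hV := valuation_qShifted_le_one (qVal p) (hneg (s + 2 * b)) (qVal_qPow p m).le s
  have hE := (hQv (s + (2 * s + 1) * a)).le
  have hS := hPz N hN hNp
  generalize qPow m ^ (s + (2 * s + 1) * a) = E1 at *
  generalize qPow m ^ (a ^ 2 + b ^ 2 + 2 * a * b + 2 * a * s + 2 * b * s + a + b + s) = E2 at *
  generalize qShifted (qPow m ^ 2) (qPow m ^ 2) (a + s) = βa at *
  generalize qShifted (qPow m ^ 2) (qPow m ^ 2) (b + s) = βb at *
  generalize qShifted (qPow m) (qPow m ^ 2) a = αa at *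
  generalize qShifted (qPow m) (qPow m ^ 2) b = αb at *
  generalize qShifted (qPow m ^ (s + 2 * a))⁻¹ (qPow m) s = W at *
  generalize qShifted (qPow m ^ (s + 2 * b))⁻¹ (qPow m) s = V at *
  generalize qShifted (qPow m ^ (s + 2 * a) * qPow m) (qPow m) s = U at *
  generalize ∑ k ∈ Finset.Icc s N, qSummand m r s k = S at *
  generalize ((P.eval z : (qVal p).integer) : RatFunc ℚ) = Z at *
  have e : S - (-1) ^ (a + b) * E2 * αa * αb * W * V / (βa * βb) =
      (S - Z) + (Z - W * U * E1 * αa ^ 2 / βa ^ 2) +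
        W * αa / (βa ^ 2 * βb) * ((U - V) * (E1 * αa * βb) +
          V * (E1 * (αa * βb) - (-1) ^ (a + b) * E2 * (αb * βa))) := by
    field_simp
    ring
  rw [e]
  refine (Valuation.map_add _ _ _).trans (max_le ((Valuation.map_add _ _ _).trans
    (max_le (hS.trans hle) hzA)) ?_)
  rw [map_mul, map_div₀, map_mul, map_mul, map_pow, hv1, hv2]
  simp only [one_pow, mul_one, div_one]
  refine mul_le_of_le_one_of_le (mul_le_one' hW hαa)
    ((Valuation.map_add _ _ _).trans (max_le ?_ ?_))
  · rw [map_mul, map_mul, map_mul, hv2, mul_one]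
    exact mul_le_of_le_of_le_one hshift (mul_le_one' hE hαa)
  · rw [map_mul]
    exact mul_le_of_le_one_of_le hV hrefl

end Main

theorem theorem2p3 (p : ℕ) [Fact p.Prime] (hp : Odd p) (m r : ℕ) (hm : 0 < m) (hr : 0 < r)
    (hpm : ¬ p ∣ m) (A B : ℕ)
    (hA : A = leastResidue p (-(r : ℚ) / m)) (hB : B = leastResidue p (-((m : ℚ) - r) / m))
    (s : ℕ) (hs : s ≤ min A B) :
    (A ≡ s + 1 [MOD 2] →
      RatFuncModEq (qInteger p ^ 2) (∑ k ∈ Finset.Icc s ((p - 1) / 2), qSummand m r s k) 0 ∧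
      RatFuncModEq (qInteger p ^ 2) (∑ k ∈ Finset.Icc s (p - 1), qSummand m r s k) 0) ∧
    (A ≡ s [MOD 2] →
      RatFuncModEq (qInteger p) (∑ k ∈ Finset.Icc s ((p - 1) / 2), qSummand m r s k)
        ((-1) ^ ((p - 1) / 2 + s) * qPow (m * (((p : ℤ) ^ 2 - 1) / 4 - (s : ℤ) ^ 2)) *
            qShifted (qPow m) (qPow (2 * m)) ((A - s) / 2) *
            qShifted (qPow m) (qPow (2 * m)) ((B - s) / 2) *
            qShifted (qPow (-(m * A))) (qPow m) s *
            qShifted (qPow (-(m * B))) (qPow m) s /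
          (qShifted (qPow (2 * m)) (qPow (2 * m)) ((A + s) / 2) *
            qShifted (qPow (2 * m)) (qPow (2 * m)) ((B + s) / 2)))) := by
  have hAp : A < p := hA ▸ leastResidue_lt p _
  have hBp : B < p := hB ▸ leastResidue_lt p _
  have hA' : (p : ℤ) ∣ r + m * A := by
    have h := dvd_add_mul_leastResidue p hpm r
    rw [hA]; exact_mod_cast h
  have hB' : (p : ℤ) ∣ (m - r) + m * B := by
    have h := dvd_add_mul_leastResidue p hpm ((m : ℤ) - r)
    rw [hB]; push_cast at h; exact h
  have hAB : A + B + 1 = p := by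
    have h := dvd_add hA' hB'
    rw [show (r + m * A + (m - r + m * B) : ℤ) = (m * (A + B + 1) : ℕ) by push_cast; ring] at h
    have h' := ((Fact.out : p.Prime).dvd_mul.mp (Int.natCast_dvd_natCast.mp h)).resolve_left hpm
    obtain ⟨c, hc⟩ := h'
    have hc2 : c < 2 := by by_contra! h2; nlinarith
    interval_cases c <;> omega
  obtain ⟨hsA, hsB⟩ := le_min_iff.mp hs
  have hodd := hp
  obtain ⟨h, hh⟩ := hp
  refine ⟨fun hpar => ⟨?_, ?_⟩, fun hpar => ?_⟩
  · refine ratFuncModEq_of_qVal_le p ?_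
    rw [sub_zero]
    exact qVal_sum_le_of_odd p hm hodd hpm hA' hB' hAB hsA hsB hpar (by omega) (by omega)
  · refine ratFuncModEq_of_qVal_le p ?_
    rw [sub_zero]
    exact qVal_sum_le_of_odd p hm hodd hpm hA' hB' hAB hsA hsB hpar (by omega) (by omega)
  · have hpar' : A % 2 = s % 2 := hpar
    obtain ⟨a, rfl⟩ : ∃ a, A = s + 2 * a := ⟨(A - s) / 2, by omega⟩
    obtain ⟨b, rfl⟩ : ∃ b, B = s + 2 * b := ⟨(B - s) / 2, by omega⟩
    obtain rfl : h = a + b + s := by omega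
    have hmain := qVal_sum_sub_le_of_even p hm hodd hpm hA' hB' hAB (N := (p - 1) / 2)
      (by omega) (by omega)
    have hexp : ((p : ℤ) ^ 2 - 1) / 4 - (s : ℤ) ^ 2 =
        (a ^ 2 + b ^ 2 + 2 * a * b + 2 * a * s + 2 * b * s + a + b + s : ℕ) := by
      have h4 : ((p : ℤ) ^ 2 - 1) = 4 * ((a + b + s) * (a + b + s + 1)) := by
        rw [hh]; push_cast; ring
      rw [h4, Int.mul_ediv_cancel_left _ (by norm_num)]
      push_cast
      ring
    have hsign : (-1 : RatFunc ℚ) ^ ((p - 1) / 2 + s) = (-1) ^ (a + b) := by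
      rw [show (p - 1) / 2 + s = a + b + 2 * s by omega, pow_add _ (a + b), pow_mul]
      simp
    rw [← pow_one (qInteger p)]
    refine ratFuncModEq_of_qVal_le p ?_
    rw [hexp, hsign, qPow_two_mul, qPow_mul_nat, qPow_neg, qPow_neg, qPow_mul_nat, qPow_mul_nat,
      show (s + 2 * a - s) / 2 = a by omega, show (s + 2 * b - s) / 2 = b by omega,
      show (s + 2 * a + s) / 2 = a + s by omega, show (s + 2 * b + s) / 2 = b + s by omega]
    exact_mod_cast hmain
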